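/- Let $K$ be a field of characteristic different from $2$ and let $C$ be an octonion algebra over $K$, that is, an eight-dimensional, not necessarily associative, $K$-algebra with multiplicative identity $e$, equipped with a non-degenerate quadratic form $N$ (the norm) such that $N(xy)=N(x)N(y)$ for all $x,y\in C$. Write $\langle x,y\rangle=N(x+y)-N(x)-N(y)$ and $\overline{x}=\langle x,e\rangle e-x$; an element $x\in C$ is called pure if $\overline{x}=-x$. Let $\operatorname{Aut}(C)$ be the group of bijective $K$-linear maps $\sigma:C\to C$ with $\sigma(xy)=\sigma(x)\sigma(y)$ for all $x,y\in C$. (1) If $x$ and $y$ are non-zero pure elements of $C$ with $N(x)=N(y)$, then there exists $\sigma\in\operatorname{Aut}(C)$ with $\sigma(x)=y$. (2) If $C$ is split, that is, if $N(x)=0$ for some non-zero $x\in C$, then $\operatorname{Aut}(C)$ acts transitively on the set of non-zero non-invertible pure elements of $C$: this set is non-empty and $\operatorname{Aut}(C)$-stable, and any two of its elements are mapped to one another by some automorphism. -/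

import Mathlib

namespace OctonionAlg

section Algebra

variable (K C : Type*) [Field K] [NonAssocRing C] [Module K C]

/-- The automorphism group of the (not necessarily associative) `K`-algebra `C`: the bijective
`K`-linear maps `σ : C → C` with `σ (x y) = σ x σ y`, under composition. -/
def Aut : Subgroup (C ≃ₗ[K] C) where
  carrier := {σ | ∀ x y : C, σ (x * y) = σ x * σ y}
  mul_mem' := by
    intro σ τ hσ hτ x y
    simp only [Set.mem_ofPred_eq] at hσ hτ
    simp only [LinearEquiv.mul_apply, hτ x y, hσ]
  one_mem' := fun _ _ => rfl
  inv_mem' := by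
    intro σ hσ x y
    simp only [Set.mem_ofPred_eq] at hσ
    apply σ.injective
    rw [hσ]
    change σ (σ.symm (x * y)) = σ (σ.symm x) * σ (σ.symm y)
    simp only [LinearEquiv.apply_symm_apply]

end Algebra

section Norm

variable {K C : Type*} [Field K] [NonAssocRing C] [Module K C]

/-- `C` is an octonion algebra over `K` with norm `N`: a unital, not necessarily associative
`K`-algebra (bilinearity of the product is expressed by the classes `SMulCommClass K C C` and
`IsScalarTower K C C`) of dimension eight, together with a non-degenerate quadratic form `N`
that permits composition. The equation `N 1 = 1` is a consequence. -/
structure IsOctonionAlgebra [SMulCommClass K C C] [IsScalarTower K C C]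
    (N : QuadraticForm K C) : Prop where
  finrank_eq : Module.finrank K C = 8
  nondegenerate : N.polarBilin.Nondegenerate
  map_mul : ∀ x y : C, N (x * y) = N x * N y

/-- The conjugate `⟨x, e⟩ e - x`, where `⟨x, y⟩ = N (x + y) - N x - N y`. -/
def conj (N : QuadraticForm K C) (x : C) : C :=
  QuadraticMap.polar N x 1 • (1 : C) - x

/-- `x` is pure if its conjugate is `-x`. -/
def IsPure (N : QuadraticForm K C) (x : C) : Prop :=
  conj N x = -x

/-- The octonion algebra with norm `N` is split: `N` is isotropic. -/
def IsSplit (N : QuadraticForm K C) : Prop :=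
  ∃ x : C, x ≠ 0 ∧ N x = 0

/-- `x` has a two-sided inverse. -/
def IsInvertible (x : C) : Prop :=
  ∃ y : C, x * y = 1 ∧ y * x = 1

/-- The set of non-zero non-invertible pure octonions. -/
def pureNonInvertible (N : QuadraticForm K C) : Set C :=
  {x | x ≠ 0 ∧ IsPure N x ∧ ¬ IsInvertible x}

end Norm

/-- The group `G` acts transitively on the subset `S` of a `G`-set: `S` is non-empty,
`G`-stable, and any two of its elements are in the same orbit. -/
def ActsTransitivelyOn (G : Type*) {X : Type*} [Group G] [MulAction G X] (S : Set X) : Prop :=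
  S.Nonempty ∧ (∀ (g : G), ∀ x ∈ S, g • x ∈ S) ∧ ∀ x ∈ S, ∀ y ∈ S, ∃ g : G, g • x = y

end OctonionAlg

/-!
An octonion algebra is obtained from the line `K 1` by adjoining, three times, a vector `w` of
non-zero norm orthogonal to the subalgebra `D` already obtained; the product on `D + D w` depends
only on that of `D` and on `N w` (`doubling_mul`). Carrying this out simultaneously in both factors
of `C × C`, with pairs of vectors of equal norm, gives a subalgebra of `C × C`
(`correspondence_double`), which becomes the graph of an automorphism once it has dimension eight
(`exists_aut_of_correspondence`).

Hence an orthogonal pair `a, b` of pure elements of non-zero norm can be moved to any other such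
pair `a', b'` with the same norms (`exists_aut_of_orthogonal_pair`): the first two doublings use
`(a, a')` and `(b, b')`, and the last one `(w, τ w)`, where `τ` is an isometry of `C` taking
`1, a, b, a b` to `1, a', b', a' b'`. Witt's theorem is not needed for `τ`: the four vectors are
orthogonal and anisotropic, so reflections match them one at a time (`exists_isometry`).

A pure `x` with `N x ≠ 0` is completed to such a pair, and its image `y` likewise by means of an
isometry. If `N x = 0` and `x ≠ 0`, then `x` lies in a hyperbolic plane of pure elements and is the
sum of an orthogonal pair of norms `1` and `-1`; writing `y` in the same way reduces this case to
pairs too. Finally, the non-invertible elements are those of norm zero. If `x` is isotropic and not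
pure, and `b` is anisotropic and orthogonal to `1` and `x`, then `x b` is isotropic, pure and
non-zero; so a split `C` has isotropic pure elements.
-/

namespace OctonionAlg

open QuadraticMap

namespace IsOctonionAlgebra

variable {K C : Type*} [Field K] [NonAssocRing C] [Module K C] [SMulCommClass K C C]
  [IsScalarTower K C C] {N : QuadraticForm K C}

/-! ### Identities in a composition algebra -/

theorem finiteDimensional (hN : IsOctonionAlgebra N) : FiniteDimensional K C :=
  FiniteDimensional.of_finrank_pos (by rw [hN.finrank_eq]; norm_num)

theorem eq_zero_of_polar (hN : IsOctonionAlgebra N) {x : C} (h : ∀ z, polar N x z = 0) : x = 0 :=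
  hN.nondegenerate.1 x h

theorem ext_polar (hN : IsOctonionAlgebra N) {x y : C} (h : ∀ z, polar N x z = polar N y z) :
    x = y :=
  sub_eq_zero.1 <| hN.eq_zero_of_polar fun z => by rw [polar_sub_left, h, sub_self]

theorem exists_ne_zero (hN : IsOctonionAlgebra N) : ∃ x : C, N x ≠ 0 := by
  by_contra! h
  have h0 : (⊤ : Submodule K C) = ⊥ :=
    (Submodule.eq_bot_iff _).2 fun x _ => hN.eq_zero_of_polar fun z => by simp [polar, h]
  have h1 : Module.finrank K (⊤ : Submodule K C) = 8 := by rw [finrank_top, hN.finrank_eq]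
  rw [h0, finrank_bot] at h1
  norm_num at h1

theorem map_one (hN : IsOctonionAlgebra N) : N (1 : C) = 1 := by
  obtain ⟨x, hx⟩ := hN.exists_ne_zero
  have h := hN.map_mul x 1
  rw [mul_one] at h
  exact mul_left_cancel₀ hx (by rw [← h, mul_one])

theorem one_ne_zero (hN : IsOctonionAlgebra N) : (1 : C) ≠ 0 := fun h => by
  have := hN.map_one
  rw [h, map_zero] at this
  exact zero_ne_one this

theorem polar_mul_left_mul_left (hN : IsOctonionAlgebra N) (x y z : C) :
    polar N (x * y) (x * z) = N x * polar N y z := by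
  simp only [polar, ← mul_add, hN.map_mul]
  ring

theorem polar_mul_right_mul_right (hN : IsOctonionAlgebra N) (x y z : C) :
    polar N (y * x) (z * x) = N x * polar N y z := by
  simp only [polar, ← add_mul, hN.map_mul]
  ring

/-- The full linearization of `N (x y) = N x N y`. -/
theorem polar_mul_add_polar_mul (hN : IsOctonionAlgebra N) (x y u z : C) :
    polar N (x * y) (u * z) + polar N (u * y) (x * z) = polar N x u * polar N y z := by
  have h := hN.polar_mul_left_mul_left (x + u) y z
  rw [add_mul, add_mul, polar_add_left, polar_add_right, polar_add_right,
    hN.polar_mul_left_mul_left, hN.polar_mul_left_mul_left, QuadraticMap.map_add N] at h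
  linear_combination h

/-- The adjoint of left multiplication by `x` is left multiplication by the conjugate of `x`. -/
theorem polar_conj_mul (hN : IsOctonionAlgebra N) (x y z : C) :
    polar N (conj N x * y) z = polar N y (x * z) := by
  have h := hN.polar_mul_add_polar_mul x y 1 z
  rw [one_mul, one_mul] at h
  rw [conj, sub_mul, smul_mul_assoc, one_mul, polar_sub_left, polar_smul_left, smul_eq_mul]
  linear_combination -h

/-- The adjoint of right multiplication by `x` is right multiplication by the conjugate of `x`. -/
theorem polar_mul_conj (hN : IsOctonionAlgebra N) (x y z : C) :
    polar N (y * conj N x) z = polar N y (z * x) := by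
  have h := hN.polar_mul_add_polar_mul y x z 1
  rw [mul_one, mul_one, polar_comm N (z * x)] at h
  rw [conj, mul_sub, mul_smul_comm, mul_one, polar_sub_left, polar_smul_left, smul_eq_mul]
  linear_combination -h

theorem conj_mul_mul_add (hN : IsOctonionAlgebra N) (x y z : C) :
    conj N x * (y * z) + conj N y * (x * z) = polar N x y • z := by
  refine hN.ext_polar fun t => ?_
  rw [polar_add_left, hN.polar_conj_mul, hN.polar_conj_mul, polar_smul_left, smul_eq_mul,
    hN.polar_mul_add_polar_mul, polar_comm N x]

theorem mul_mul_conj_add (hN : IsOctonionAlgebra N) (x y z : C) :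
    z * y * conj N x + z * x * conj N y = polar N x y • z := by
  refine hN.ext_polar fun t => ?_
  have h := hN.polar_mul_add_polar_mul z y t x
  rw [polar_add_left, hN.polar_mul_conj, hN.polar_mul_conj, polar_smul_left, smul_eq_mul]
  rw [polar_comm N (t * y), polar_comm N y] at h
  linear_combination h

theorem mul_mul_conj (hN : IsOctonionAlgebra N) (x y : C) : y * x * conj N x = N x • y :=
  hN.ext_polar fun t => by
    rw [hN.polar_mul_conj, hN.polar_mul_right_mul_right, polar_smul_left, smul_eq_mul]

theorem mul_conj (hN : IsOctonionAlgebra N) (x : C) : x * conj N x = N x • (1 : C) := by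
  simpa using hN.mul_mul_conj x 1

theorem conj_mul_self (hN : IsOctonionAlgebra N) (x : C) : conj N x * x = N x • (1 : C) := by
  rw [← hN.mul_conj, conj, sub_mul, mul_sub, smul_mul_assoc, mul_smul_comm, one_mul, mul_one]

theorem polar_conj_left (hN : IsOctonionAlgebra N) (x z : C) :
    polar N (conj N x) z = polar N 1 (x * z) := by
  simpa using hN.polar_conj_mul x 1 z

theorem conj_conj (hN : IsOctonionAlgebra N) (x : C) : conj N (conj N x) = x := by
  have h : polar N (conj N x) 1 = polar N x 1 := by
    rw [hN.polar_conj_left, mul_one, polar_comm]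
  rw [conj, h, conj, sub_sub_cancel]

theorem conj_mul (hN : IsOctonionAlgebra N) (x y : C) :
    conj N (x * y) = conj N y * conj N x := by
  refine hN.ext_polar fun z => ?_
  have h1 : polar N (x * y * z) 1 = polar N y (conj N x * conj N z) := by
    conv_lhs => rw [← hN.conj_conj z, hN.polar_mul_conj, one_mul, ← hN.conj_conj x,
      hN.polar_conj_mul]
  have h2 : polar N (x * (y * z)) 1 = polar N y (conj N x * conj N z) := by
    conv_lhs => rw [← hN.conj_conj x, hN.polar_conj_mul, mul_one, ← hN.conj_conj z,
      hN.polar_mul_conj]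
  rw [hN.polar_conj_left, hN.polar_conj_mul, hN.polar_conj_left, polar_comm, h1,
    polar_comm N 1 (x * (y * z)), h2]

theorem isPure_iff (hN : IsOctonionAlgebra N) {x : C} : IsPure N x ↔ polar N x 1 = 0 := by
  rw [IsPure, conj, sub_eq_neg_self, smul_eq_zero, or_iff_left hN.one_ne_zero]

omit [SMulCommClass K C C] [IsScalarTower K C C] in
theorem polar_conj_eq_zero {x w : C} (h1 : polar N w 1 = 0)
    (hx : polar N x w = 0) : polar N (conj N x) w = 0 := by
  rw [conj, polar_sub_left, polar_smul_left, hx, polar_comm N 1, h1]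
  simp

theorem mul_eq_mul_conj (hN : IsOctonionAlgebra N) {v w : C} (h1 : polar N w 1 = 0)
    (hv : polar N v w = 0) : v * w = w * conj N v := by
  have h := hN.conj_mul_mul_add (conj N v) w 1
  rw [mul_one, mul_one, hN.conj_conj, polar_conj_eq_zero h1 hv, zero_smul,
    hN.isPure_iff.2 h1, neg_mul, ← sub_eq_add_neg] at h
  exact sub_eq_zero.1 h

/-! ### The doubling formula -/

omit [SMulCommClass K C C] [IsScalarTower K C C] in
theorem conj_mem {D : Submodule K C} (h1 : 1 ∈ D) {x : C} (hx : x ∈ D) : conj N x ∈ D :=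
  D.sub_mem (D.smul_mem _ h1) hx

/-- If `w` is orthogonal to the subalgebra `D`, so are all products `y w` with `y ∈ D`. -/
theorem polar_mul_eq_zero (hN : IsOctonionAlgebra N) {D : Submodule K C} (h1 : 1 ∈ D)
    (hD : ∀ x ∈ D, ∀ y ∈ D, x * y ∈ D) {w : C} (hw : ∀ x ∈ D, polar N x w = 0) {x y : C}
    (hx : x ∈ D) (hy : y ∈ D) : polar N x (y * w) = 0 := by
  rw [← hN.polar_conj_mul]
  exact hw _ (hD _ (conj_mem h1 hy) _ hx)

/-- The Cayley-Dickson multiplication rule: a subalgebra `D` and one vector `w` orthogonal to it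
determine the product on `D + D w`, up to the value `N w`. -/
theorem doubling_mul (hN : IsOctonionAlgebra N) {D : Submodule K C} (h1 : 1 ∈ D)
    (hD : ∀ x ∈ D, ∀ y ∈ D, x * y ∈ D) {w : C} (hw : ∀ x ∈ D, polar N x w = 0) {x y u v : C}
    (hx : x ∈ D) (hy : y ∈ D) (hu : u ∈ D) (hv : v ∈ D) :
    (x + y * w) * (u + v * w) =
      (x * u - N w • (conj N v * y)) + (v * x + y * conj N u) * w := by
  have hw1 : polar N w 1 = 0 := by rw [polar_comm]; exact hw 1 h1
  have hwc : conj N w = -w := hN.isPure_iff.2 hw1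
  have hxv : x * (v * w) = v * x * w := by
    have h := hN.conj_mul_mul_add (conj N x) w (conj N v)
    rw [hN.conj_conj, polar_conj_eq_zero hw1 (hw x hx), zero_smul, hwc, neg_mul,
      ← sub_eq_add_neg, sub_eq_zero] at h
    rw [hN.mul_eq_mul_conj hw1 (hw v hv), h, ← hN.conj_mul,
      ← hN.mul_eq_mul_conj hw1 (hw _ (hD v hv x hx))]
  have hyu : y * w * u = y * conj N u * w := by
    have h := hN.mul_mul_conj_add (conj N u) w y
    rw [hN.conj_conj, polar_conj_eq_zero hw1 (hw u hu), zero_smul, hwc, mul_neg,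
      ← sub_eq_add_neg, sub_eq_zero] at h
    exact h
  have hyv : y * w * (v * w) = -(N w • (conj N v * y)) := by
    have hyw : conj N (y * w) = -(y * w) := hN.isPure_iff.2 <| by
      rw [polar_comm]; exact hN.polar_mul_eq_zero h1 hD hw h1 hy
    have h := hN.conj_mul_mul_add (y * w) v w
    have h' := hN.mul_mul_conj w y
    rw [hwc, mul_neg, neg_eq_iff_eq_neg] at h'
    rw [polar_comm, hN.polar_mul_eq_zero h1 hD hw hv hy, zero_smul, hyw, h', neg_mul, mul_neg,
      mul_smul_comm, ← neg_add, neg_eq_zero] at h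
    exact eq_neg_of_add_eq_zero_left h
  rw [add_mul, mul_add, mul_add, hxv, hyu, hyv, add_mul]
  abel

/-! ### Non-degenerate subspaces and reflections -/

/-- The restriction of the polar form of `N` to the subspace `D` is non-degenerate. -/
def _root_.OctonionAlg.NondegOn (N : QuadraticForm K C) (D : Submodule K C) : Prop :=
  ∀ x ∈ D, (∀ y ∈ D, polar N x y = 0) → x = 0

theorem exists_orthogonal (hN : IsOctonionAlgebra N) {D : Submodule K C} (hD : NondegOn N D)
    (hlt : Module.finrank K D < 8) : ∃ w, (∀ x ∈ D, polar N x w = 0) ∧ N w ≠ 0 := by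
  have := hN.finiteDimensional
  have hrefl : N.polarBilin.IsRefl := fun x y h => by
    rw [polarBilin_apply_apply] at h ⊢; rwa [polar_comm]
  have hnd : (LinearMap.BilinForm.restrict N.polarBilin D).Nondegenerate := by
    refine ⟨fun x hx => Subtype.ext (hD x x.2 fun y hy => hx ⟨y, hy⟩),
      fun x hx => Subtype.ext (hD x x.2 fun y hy => ?_)⟩
    rw [polar_comm]
    exact hx ⟨y, hy⟩
  have hc := LinearMap.BilinForm.isCompl_orthogonal_of_restrict_nondegenerate hrefl hnd
  by_contra! h
  -- otherwise `N`, hence its polar form, vanishes on the orthogonal complement of `D`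
  have hbot : LinearMap.BilinForm.orthogonal N.polarBilin D = ⊥ := by
    refine (Submodule.eq_bot_iff _).2 fun x hx => hN.eq_zero_of_polar fun z => ?_
    have hz : z ∈ D ⊔ LinearMap.BilinForm.orthogonal N.polarBilin D := hc.sup_eq_top ▸ Submodule.mem_top
    obtain ⟨d, hd, t, ht, rfl⟩ := Submodule.mem_sup.1 hz
    have hz : ∀ s ∈ LinearMap.BilinForm.orthogonal N.polarBilin D, N s = 0 := fun s hs => h s fun y hy => hs y hy
    rw [polar_add_right, polar_comm N x d, show polar N d x = 0 from hx d hd, polar,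
      hz _ (Submodule.add_mem _ hx ht), hz _ hx, hz _ ht]
    simp
  have htop : D = ⊤ := by simpa [hbot] using hc.sup_eq_top
  rw [htop, finrank_top, hN.finrank_eq] at hlt
  exact lt_irrefl _ hlt

omit [SMulCommClass K C C] [IsScalarTower K C C] in
theorem exists_reflection (v : C) (hv : N v ≠ 0) :
    ∃ τ : C →ₗ[K] C, (∀ z, N (τ z) = N z) ∧ ∀ z, τ z = z - (polar N z v / N v) • v := by
  refine ⟨LinearMap.id - ((N v)⁻¹ • N.polarBilin.flip v).smulRight v, fun z => ?_, fun z => ?_⟩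
  · simp only [LinearMap.sub_apply, LinearMap.id_apply, LinearMap.smulRight_apply,
      LinearMap.smul_apply, LinearMap.flip_apply, polarBilin_apply_apply, smul_eq_mul]
    rw [sub_eq_add_neg, QuadraticMap.map_add N, QuadraticMap.map_neg, QuadraticMap.map_smul,
      polar_neg_right, polar_smul_right]
    simp only [smul_eq_mul]
    field_simp
    ring
  · simp [div_eq_inv_mul]

omit [SMulCommClass K C C] [IsScalarTower K C C] in
/-- Vectors `a` and `b` of equal non-zero norm are related by a product of at most two
reflections, which fixes whatever is orthogonal to both: one of `a - b` and `a + b` is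
anisotropic, and the reflections in these vectors take `a` to `b` and to `-b`. -/
theorem exists_isometry (h2 : (2 : K) ≠ 0) {a b : C} (hab : N a = N b) (hb : N b ≠ 0) :
    ∃ τ : C →ₗ[K] C, (∀ z, N (τ z) = N z) ∧ τ a = b ∧
      ∀ z, polar N z a = 0 → polar N z b = 0 → τ z = z := by
  by_cases h : N (a - b) = 0
  · have hadd := QuadraticMap.map_add N a b
    have hsub := QuadraticMap.map_add N a (-b)
    rw [polar_neg_right, QuadraticMap.map_neg, ← sub_eq_add_neg, h, hab] at hsub
    rw [hab] at hadd
    have hp : N (a + b) = 2 * polar N a b := by linear_combination hadd - hsub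
    have hp' : polar N a b = 2 * N b := by linear_combination hsub
    obtain ⟨τ, hτN, hτ⟩ := exists_reflection (a + b) (by rw [hp, hp']; positivity)
    obtain ⟨ρ, hρN, hρ⟩ := exists_reflection b hb
    refine ⟨ρ ∘ₗ τ, fun z => by simp [hτN, hρN], ?_, fun z hza hzb => ?_⟩
    · have hτa : τ a = -b := by
        have : polar N a (a + b) / N (a + b) = 1 := by
          rw [polar_add_right, polar_self, hp, hp', hab, nsmul_eq_mul]
          push_cast
          field_simp
          norm_num
        rw [hτ, this, one_smul]
        abel
      have : polar N (-b) b / N b = -2 := by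
        rw [polar_neg_left, polar_self, nsmul_eq_mul]
        push_cast
        field_simp
      rw [LinearMap.comp_apply, hτa, hρ, this, neg_smul, two_smul]
      abel
    · rw [LinearMap.comp_apply, hτ, polar_add_right, hza, hzb]
      simp [hρ, hzb]
  · obtain ⟨τ, hτN, hτ⟩ := exists_reflection (a - b) h
    refine ⟨τ, hτN, ?_, fun z hza hzb => ?_⟩
    · have : polar N a (a - b) / N (a - b) = 1 := by
        rw [div_eq_one_iff_eq h, polar_sub_right, polar_self, sub_eq_add_neg,
          sub_eq_add_neg a b, QuadraticMap.map_add N, polar_neg_right, QuadraticMap.map_neg,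
          nsmul_eq_mul]
        push_cast
        linear_combination hab
      rw [hτ, this, one_smul, sub_sub_cancel]
    · rw [hτ, polar_sub_right, hza, hzb]
      simp

omit [SMulCommClass K C C] [IsScalarTower K C C] in
theorem polar_isometry {τ : C →ₗ[K] C} (h : ∀ z, N (τ z) = N z) (x y : C) :
    polar N (τ x) (τ y) = polar N x y := by
  rw [polar, ← _root_.map_add, h, h, h, polar]

/-! ### Norm-preserving correspondences -/

/-- A subspace `G` of `C × C` that contains `(1, 1)`, is closed under multiplication and has
`N x = N y` for all `(x, y) ∈ G`, and whose first projection is non-degenerate of dimension `n`.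
It stands for the graph of an isomorphism between two subalgebras of `C`. -/
structure _root_.OctonionAlg.Correspondence (N : QuadraticForm K C) (G : Submodule K (C × C))
    (n : ℕ) : Prop where
  one_mem : (1 : C × C) ∈ G
  mul_mem : ∀ p ∈ G, ∀ q ∈ G, p * q ∈ G
  norm_eq : ∀ p ∈ G, N p.1 = N p.2
  nondeg : NondegOn N (G.map (LinearMap.fst K C C))
  finrank_eq : Module.finrank K (G.map (LinearMap.fst K C C)) = n

/-- The doubling `G + G p` of a correspondence `G` by a pair `p` of vectors. -/
def _root_.OctonionAlg.double (G : Submodule K (C × C)) (p : C × C) : Submodule K (C × C) :=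
  G ⊔ G.map (LinearMap.mulRight K p)

omit [SMulCommClass K C C] in
theorem mem_double {G : Submodule K (C × C)} {p q : C × C} :
    q ∈ double G p ↔ ∃ x ∈ G, ∃ y ∈ G, x + y * p = q := by
  simp only [double, Submodule.mem_sup, Submodule.mem_map, exists_exists_and_eq_and,
    LinearMap.mulRight_apply]

omit [SMulCommClass K C C] [IsScalarTower K C C] in
theorem correspondence_polar {G : Submodule K (C × C)} {n : ℕ} (hG : Correspondence N G n)
    {p q : C × C} (hp : p ∈ G) (hq : q ∈ G) : polar N p.1 q.1 = polar N p.2 q.2 := by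
  have h := hG.norm_eq _ (G.add_mem hp hq)
  simp only [polar]
  rw [hG.norm_eq p hp, hG.norm_eq q hq, ← Prod.fst_add, ← Prod.snd_add, h]

/-- The trivial correspondence, spanned by `(1, 1)`. -/
theorem correspondence_one (hN : IsOctonionAlgebra N) (h2 : (2 : K) ≠ 0) :
    Correspondence N (Submodule.span K {(1 : C × C)}) 1 := by
  have hmap : (Submodule.span K {(1 : C × C)}).map (LinearMap.fst K C C) =
      Submodule.span K {1} := by
    rw [Submodule.map_span]
    simp
  refine ⟨Submodule.mem_span_singleton_self _, fun p hp q hq => ?_, fun p hp => ?_, ?_, ?_⟩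
  · obtain ⟨s, rfl⟩ := Submodule.mem_span_singleton.1 hp
    obtain ⟨t, rfl⟩ := Submodule.mem_span_singleton.1 hq
    rw [smul_mul_assoc, one_mul]
    exact Submodule.smul_mem _ _ hq
  · obtain ⟨s, rfl⟩ := Submodule.mem_span_singleton.1 hp
    rfl
  · rw [hmap]
    intro x hx h
    obtain ⟨s, rfl⟩ := Submodule.mem_span_singleton.1 hx
    have h := h 1 (Submodule.mem_span_singleton_self _)
    rw [polar_smul_left, polar_self, hN.map_one] at h
    have : s = 0 := by simpa [h2] using h
    rw [this, zero_smul]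
  · rw [hmap]
    exact finrank_span_singleton hN.one_ne_zero

/-- Doubling by a pair of vectors of equal non-zero norm, orthogonal to the two projections,
takes a correspondence to one of twice its dimension. -/
theorem correspondence_double (hN : IsOctonionAlgebra N) {G : Submodule K (C × C)} {n : ℕ}
    (hG : Correspondence N G n) {p : C × C} (h1 : ∀ q ∈ G, polar N q.1 p.1 = 0)
    (h2 : ∀ q ∈ G, polar N q.2 p.2 = 0) (hp : N p.1 = N p.2) (h0 : N p.1 ≠ 0) :
    Correspondence N (double G p) (2 * n) := by
  have := hN.finiteDimensional
  set D := G.map (LinearMap.fst K C C) with hDdef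
  set E := G.map (LinearMap.snd K C C) with hEdef
  have hD1 : ∀ q ∈ G, q.1 ∈ D := fun q hq => ⟨q, hq, rfl⟩
  have hE1 : ∀ q ∈ G, q.2 ∈ E := fun q hq => ⟨q, hq, rfl⟩
  have oneD : (1 : C) ∈ D := hD1 _ hG.one_mem
  have oneE : (1 : C) ∈ E := hE1 _ hG.one_mem
  have mulD : ∀ x ∈ D, ∀ y ∈ D, x * y ∈ D := by
    rintro _ ⟨x, hx, rfl⟩ _ ⟨y, hy, rfl⟩
    exact hD1 _ (hG.mul_mem x hx y hy)
  have mulE : ∀ x ∈ E, ∀ y ∈ E, x * y ∈ E := by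
    rintro _ ⟨x, hx, rfl⟩ _ ⟨y, hy, rfl⟩
    exact hE1 _ (hG.mul_mem x hx y hy)
  have orthD : ∀ x ∈ D, polar N x p.1 = 0 := by
    rintro _ ⟨x, hx, rfl⟩; exact h1 x hx
  have orthE : ∀ x ∈ E, polar N x p.2 = 0 := by
    rintro _ ⟨x, hx, rfl⟩; exact h2 x hx
  have hconj : ∀ q ∈ G, (conj N q.1, conj N q.2) ∈ G := fun q hq => by
    have := G.sub_mem (G.smul_mem (polar N q.1 1) hG.one_mem) hq
    have h := correspondence_polar hG hq hG.one_mem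
    convert this using 1
    ext
    · rfl
    · change polar N q.2 1 • (1 : C) - q.2 = polar N q.1 1 • (1 : C) - q.2
      exact congrArg (fun t => t • (1 : C) - q.2) h.symm
  have hmap : ∀ z, z ∈ (double G p).map (LinearMap.fst K C C) ↔
      ∃ x ∈ D, ∃ y ∈ D, x + y * p.1 = z := by
    intro z
    constructor
    · rintro ⟨q, hq, rfl⟩
      obtain ⟨x, hx, y, hy, rfl⟩ := mem_double.1 hq
      exact ⟨_, hD1 x hx, _, hD1 y hy, rfl⟩
    · rintro ⟨_, ⟨x, hx, rfl⟩, _, ⟨y, hy, rfl⟩, rfl⟩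
      exact ⟨x + y * p, mem_double.2 ⟨x, hx, y, hy, rfl⟩, rfl⟩
  have key : ∀ x ∈ D, ∀ y ∈ D, (∀ u ∈ D, ∀ v ∈ D, polar N (x + y * p.1) (u + v * p.1) = 0) →
      x = 0 ∧ y = 0 := by
    intro x hx y hy h
    constructor
    · refine hG.nondeg x hx fun u hu => ?_
      have h := h u hu 0 D.zero_mem
      rwa [zero_mul, add_zero, polar_add_left, polar_comm N (y * p.1),
        hN.polar_mul_eq_zero oneD mulD orthD hu hy, add_zero] at h
    · refine hG.nondeg y hy fun v hv => ?_
      have h := h 0 D.zero_mem v hv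
      rw [zero_add, polar_add_left, hN.polar_mul_eq_zero oneD mulD orthD hx hv, zero_add,
        hN.polar_mul_right_mul_right] at h
      exact (mul_eq_zero.1 h).resolve_left h0
  refine ⟨?_, ?_, ?_, ?_, ?_⟩
  · exact mem_double.2 ⟨1, hG.one_mem, 0, G.zero_mem, by simp⟩
  · intro q hq r hr
    obtain ⟨x, hx, y, hy, rfl⟩ := mem_double.1 hq
    obtain ⟨u, hu, v, hv, rfl⟩ := mem_double.1 hr
    refine mem_double.2 ⟨x * u - N p.1 • ((conj N v.1, conj N v.2) * y),
      G.sub_mem (hG.mul_mem _ hx _ hu) (G.smul_mem _ (hG.mul_mem _ (hconj v hv) _ hy)),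
      v * x + y * (conj N u.1, conj N u.2),
      G.add_mem (hG.mul_mem _ hv _ hx) (hG.mul_mem _ hy _ (hconj u hu)), ?_⟩
    ext
    · exact (hN.doubling_mul oneD mulD orthD (hD1 x hx) (hD1 y hy) (hD1 u hu) (hD1 v hv)).symm
    · have h := hN.doubling_mul oneE mulE orthE (hE1 x hx) (hE1 y hy) (hE1 u hu) (hE1 v hv)
      rw [← hp] at h
      exact h.symm
  · intro q hq
    obtain ⟨x, hx, y, hy, rfl⟩ := mem_double.1 hq
    simp only [Prod.fst_add, Prod.snd_add, Prod.fst_mul, Prod.snd_mul]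
    rw [QuadraticMap.map_add N, QuadraticMap.map_add N,
      hN.polar_mul_eq_zero oneD mulD orthD (hD1 x hx) (hD1 y hy),
      hN.polar_mul_eq_zero oneE mulE orthE (hE1 x hx) (hE1 y hy), hN.map_mul, hN.map_mul,
      hG.norm_eq x hx, hG.norm_eq y hy, hp]
  · intro z hz h
    obtain ⟨x, hx, y, hy, rfl⟩ := (hmap z).1 hz
    obtain ⟨rfl, rfl⟩ := key x hx y hy fun u hu v hv => h _ ((hmap _).2 ⟨u, hu, v, hv, rfl⟩)
    simp
  · -- the map `(x, y) ↦ x + y p.1` from `D × D` is injective, with image the first projection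
    let f : D × D →ₗ[K] C :=
      LinearMap.coprod D.subtype (LinearMap.mulRight K p.1 ∘ₗ D.subtype)
    have hf : Function.Injective f := by
      refine (injective_iff_map_eq_zero f).2 fun q hq => ?_
      have hq : (q.1 : C) + q.2 * p.1 = 0 := hq
      have := key q.1 q.1.2 q.2 q.2.2 fun u _ v _ => by rw [hq, polar_zero_left]
      exact Prod.ext (Subtype.ext this.1) (Subtype.ext this.2)
    have hr : (double G p).map (LinearMap.fst K C C) = LinearMap.range f := by
      ext z
      rw [hmap]
      constructor
      · rintro ⟨x, hx, y, hy, rfl⟩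
        exact ⟨(⟨x, hx⟩, ⟨y, hy⟩), rfl⟩
      · rintro ⟨q, rfl⟩
        exact ⟨q.1, q.1.2, q.2, q.2.2, rfl⟩
    rw [hr, LinearMap.finrank_range_of_inj hf, Module.finrank_prod, hDdef, hG.finrank_eq, two_mul]

/-- A correspondence of full dimension is the graph of an automorphism. -/
theorem exists_aut_of_correspondence (hN : IsOctonionAlgebra N) {G : Submodule K (C × C)}
    (hG : Correspondence N G 8) : ∃ σ ∈ Aut K C, ∀ p ∈ G, σ p.1 = p.2 := by
  have := hN.finiteDimensional
  let f : G →ₗ[K] C := LinearMap.fst K C C ∘ₗ G.subtype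
  let g : G →ₗ[K] C := LinearMap.snd K C C ∘ₗ G.subtype
  have htop : G.map (LinearMap.fst K C C) = ⊤ :=
    Submodule.eq_top_of_finrank_eq (by rw [hG.finrank_eq, hN.finrank_eq])
  have hfs : Function.Surjective f := fun x => by
    have hx : x ∈ G.map (LinearMap.fst K C C) := htop ▸ Submodule.mem_top
    obtain ⟨p, hp, rfl⟩ := hx
    exact ⟨⟨p, hp⟩, rfl⟩
  have hgi : Function.Injective g := by
    refine (injective_iff_map_eq_zero g).2 fun p hp => ?_
    have hp : p.1.2 = 0 := hp
    refine Subtype.ext (Prod.ext (hN.eq_zero_of_polar fun z => ?_) hp)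
    obtain ⟨q, rfl⟩ := hfs z
    exact (correspondence_polar hG p.2 q.2).trans (by rw [hp, polar_zero_left])
  have hrank : Module.finrank K G = Module.finrank K C :=
    le_antisymm (LinearMap.finrank_le_finrank_of_injective hgi)
      (LinearMap.finrank_le_finrank_of_surjective hfs)
  have hfi : Function.Injective f :=
    (LinearMap.injective_iff_surjective_of_finrank_eq_finrank hrank).2 hfs
  have hgs : Function.Surjective g :=
    (LinearMap.injective_iff_surjective_of_finrank_eq_finrank hrank).1 hgi
  let σ : C ≃ₗ[K] C :=
    (LinearEquiv.ofBijective f ⟨hfi, hfs⟩).symm ≪≫ₗ LinearEquiv.ofBijective g ⟨hgi, hgs⟩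
  have hσ : ∀ p ∈ G, σ p.1 = p.2 := fun p hp => by
    have : (LinearEquiv.ofBijective f ⟨hfi, hfs⟩).symm p.1 = ⟨p, hp⟩ :=
      (LinearEquiv.symm_apply_eq _).2 rfl
    change g ((LinearEquiv.ofBijective f ⟨hfi, hfs⟩).symm p.1) = p.2
    rw [this]
    rfl
  refine ⟨σ, fun x y => ?_, hσ⟩
  obtain ⟨p, rfl⟩ := hfs x
  obtain ⟨q, rfl⟩ := hfs y
  exact (hσ _ (hG.mul_mem _ p.2 _ q.2)).trans (congrArg₂ _ (hσ _ p.2).symm (hσ _ q.2).symm)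

/-! ### Automorphisms moving pure elements -/

/-- Two orthogonal pairs of anisotropic pure elements with the same norms are related by an
automorphism. Both pairs generate quaternion subalgebras, and an isometry of `C` matching these,
built from reflections, provides vectors by which to double them to `C`. -/
theorem exists_aut_of_orthogonal_pair (hN : IsOctonionAlgebra N) (h2 : (2 : K) ≠ 0)
    {a b a' b' : C} (ha : polar N a 1 = 0) (hb : polar N b 1 = 0) (hab : polar N a b = 0)
    (ha' : polar N a' 1 = 0) (hb' : polar N b' 1 = 0) (hab' : polar N a' b' = 0)
    (hNa : N a = N a') (hNb : N b = N b') (ha0 : N a ≠ 0) (hb0 : N b ≠ 0) :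
    ∃ σ ∈ Aut K C, σ a = a' ∧ σ b = b' := by
  have comm := polar_comm N (M := C)
  have hG1 := hN.correspondence_double (p := (a, a')) (hN.correspondence_one h2)
    (fun q hq => by
      obtain ⟨s, rfl⟩ := Submodule.mem_span_singleton.1 hq
      simp [polar_smul_left, comm 1, ha])
    (fun q hq => by
      obtain ⟨s, rfl⟩ := Submodule.mem_span_singleton.1 hq
      simp [polar_smul_left, comm 1, ha'])
    hNa ha0
  set G1 := double (Submodule.span K {(1 : C × C)}) (a, a') with hG1def
  have mem1 : ∀ q, q ∈ G1 ↔ ∃ s t : K, s • (1 : C × C) + t • (a, a') = q := fun q => by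
    simp [hG1def, mem_double, Submodule.mem_span_singleton]
  have hG2 := hN.correspondence_double (p := (b, b')) hG1
    (fun q hq => by
      obtain ⟨s, t, rfl⟩ := (mem1 q).1 hq
      simp [polar_add_left, polar_smul_left, comm 1, hb, hab])
    (fun q hq => by
      obtain ⟨s, t, rfl⟩ := (mem1 q).1 hq
      simp [polar_add_left, polar_smul_left, comm 1, hb', hab'])
    hNb hb0
  set G2 := double G1 (b, b') with hG2def
  have haG1 : ((a, a') : C × C) ∈ G1 := (mem1 _).2 ⟨0, 1, by simp⟩
  have haG : ((a, a') : C × C) ∈ G2 := mem_double.2 ⟨_, haG1, 0, G1.zero_mem, by simp⟩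
  have hbG : ((b, b') : C × C) ∈ G2 := mem_double.2 ⟨0, G1.zero_mem, 1, hG1.one_mem, by simp⟩
  have hcG : ((a * b, a' * b') : C × C) ∈ G2 := hG2.mul_mem _ haG _ hbG
  have mem2 : ∀ q ∈ G2, ∃ s t u v : K,
      s • (1 : C × C) + t • (a, a') + u • (b, b') + v • (a * b, a' * b') = q := by
    intro q hq
    obtain ⟨x, hx, y, hy, rfl⟩ := mem_double.1 hq
    obtain ⟨s, t, rfl⟩ := (mem1 x).1 hx
    obtain ⟨u, v, rfl⟩ := (mem1 y).1 hy
    exact ⟨s, t, u, v, by rw [add_mul, smul_mul_assoc, smul_mul_assoc, one_mul, Prod.mk_mul_mk,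
      add_assoc]⟩
  -- the product of an orthogonal pair of pure elements is pure and orthogonal to both
  have prod : ∀ {a b : C}, polar N a 1 = 0 → polar N b 1 = 0 → polar N a b = 0 →
      polar N 1 (a * b) = 0 ∧ polar N a (a * b) = 0 ∧ polar N b (a * b) = 0 := by
    intro a b ha hb hab
    refine ⟨?_, ?_, ?_⟩
    · rw [← hN.polar_conj_left, hN.isPure_iff.2 ha, polar_neg_left, hab, neg_zero]
    · have := hN.polar_mul_left_mul_left a 1 b
      rwa [mul_one, comm 1 b, hb, mul_zero] at this
    · have := hN.polar_mul_right_mul_right b 1 a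
      rwa [one_mul, comm 1 a, ha, mul_zero] at this
  obtain ⟨hc1, hca, hcb⟩ := prod ha hb hab
  obtain ⟨hc1', hca', hcb'⟩ := prod ha' hb' hab'
  -- an isometry of `C` that agrees with the correspondence
  obtain ⟨τ₁, h1N, h1a, h1f⟩ := exists_isometry h2 hNa (hNa ▸ ha0)
  have h11 : τ₁ 1 = 1 := h1f 1 (by rw [comm, ha]) (by rw [comm, ha'])
  have p1 := polar_isometry h1N
  obtain ⟨τ₂, h2N, h2b, h2f⟩ := exists_isometry h2 (a := τ₁ b) (b := b') (by rw [h1N, hNb])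
    (hNb ▸ hb0)
  have h21 : τ₂ 1 = 1 := h2f 1 (by rw [← h11, p1, comm, hb]) (by rw [comm, hb'])
  have h2a : τ₂ a' = a' := h2f a' (by rw [← h1a, p1, hab]) hab'
  have p2 := polar_isometry h2N
  obtain ⟨τ₃, h3N, h3c, h3f⟩ := exists_isometry h2 (a := τ₂ (τ₁ (a * b))) (b := a' * b')
    (by rw [h2N, h1N, hN.map_mul, hN.map_mul, hNa, hNb])
    (by rw [hN.map_mul, ← hNa, ← hNb]; exact mul_ne_zero ha0 hb0)
  have h31 : τ₃ 1 = 1 := h3f 1 (by conv_lhs => rw [← h21, p2, ← h11, p1, hc1]) hc1'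
  have h3a : τ₃ a' = a' := h3f a' (by conv_lhs => rw [← h2a, p2, ← h1a, p1, hca]) hca'
  have h3b : τ₃ b' = b' := h3f b' (by conv_lhs => rw [← h2b, p2, p1, hcb]) hcb'
  have p3 := polar_isometry h3N
  obtain ⟨τ, hτ⟩ : ∃ τ : C →ₗ[K] C, τ = τ₃ ∘ₗ τ₂ ∘ₗ τ₁ := ⟨_, rfl⟩
  have hτN : ∀ z, N (τ z) = N z := fun z => by simp [hτ, h1N, h2N, h3N]
  have hτG : ∀ q ∈ G2, τ q.1 = q.2 := fun q hq => by
    obtain ⟨s, t, u, v, rfl⟩ := mem2 q hq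
    simp [hτ, h11, h1a, h21, h2a, h2b, h31, h3a, h3b, h3c]
  obtain ⟨w, hw, hw0⟩ := hN.exists_orthogonal hG2.nondeg (by rw [hG2.finrank_eq]; norm_num)
  have hG3 := hN.correspondence_double (p := (w, τ w)) hG2
    (fun q hq => hw _ ⟨q, hq, rfl⟩)
    (fun q hq => by
      rw [← hτG q hq, polar_isometry hτN]
      exact hw _ ⟨q, hq, rfl⟩)
    (hτN w).symm hw0
  obtain ⟨σ, hσ, hσG⟩ := hN.exists_aut_of_correspondence hG3
  have incl : ∀ q ∈ G2, q ∈ double G2 (w, τ w) := fun q hq =>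
    mem_double.2 ⟨q, hq, 0, G2.zero_mem, by simp⟩
  exact ⟨σ, hσ, hσG _ (incl _ haG), hσG _ (incl _ hbG)⟩

/-- A non-zero isotropic pure element is the sum of two orthogonal pure elements of norms
`1` and `-1`. -/
theorem exists_orthogonal_pair_of_isotropic (hN : IsOctonionAlgebra N) (h2 : (2 : K) ≠ 0) {x : C}
    (hx0 : x ≠ 0) (hx : polar N x 1 = 0) (hNx : N x = 0) :
    ∃ a b : C, polar N a 1 = 0 ∧ polar N b 1 = 0 ∧ polar N a b = 0 ∧ N a = 1 ∧ N b = -1 ∧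
      a + b = x := by
  have h11 : polar N (1 : C) 1 = 2 := by rw [polar_self, hN.map_one]; norm_num
  have hxx : polar N x x = 0 := by rw [polar_self, hNx, smul_zero]
  obtain ⟨z, hz⟩ : ∃ z, polar N x z ≠ 0 := by
    by_contra! h
    exact hx0 (hN.eq_zero_of_polar h)
  -- a pure element `y` with `⟨x, y⟩ = 2`, then an isotropic one `p`
  obtain ⟨y, hy1, hxy⟩ : ∃ y, polar N y 1 = 0 ∧ polar N x y = 2 := by
    refine ⟨(2 / polar N x z) • (z - (polar N z 1 / 2) • (1 : C)), ?_, ?_⟩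
    · rw [polar_smul_left, polar_sub_left, polar_smul_left, h11, smul_eq_mul, smul_eq_mul]
      field_simp
      ring
    · rw [polar_smul_right, polar_sub_right, polar_smul_right, hx, smul_eq_mul]
      field_simp
      simp
  obtain ⟨p, hp1, hxp, hp⟩ : ∃ p, polar N p 1 = 0 ∧ polar N x p = 2 ∧ N p = 0 := by
    refine ⟨y + (-(N y / 2)) • x, ?_, ?_, ?_⟩
    · rw [polar_add_left, polar_smul_left, hy1, hx]; simp
    · rw [polar_add_right, polar_smul_right, hxy, hxx]; simp
    · rw [QuadraticMap.map_add N, QuadraticMap.map_smul, hNx, polar_smul_right, polar_comm, hxy,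
        smul_eq_mul, smul_eq_mul]
      field_simp
      ring
  refine ⟨(1 / 2 : K) • x + p, (1 / 2 : K) • x - p, ?_, ?_, ?_, ?_, ?_, ?_⟩
  · rw [polar_add_left, polar_smul_left, hx, hp1]; simp
  · rw [polar_sub_left, polar_smul_left, hx, hp1]; simp
  · rw [polar_add_left, polar_sub_right, polar_sub_right, polar_smul_left, polar_smul_left,
      polar_smul_right, polar_smul_right, hxx, polar_self, hp, polar_comm N p x]
    simp
  · rw [QuadraticMap.map_add N, QuadraticMap.map_smul, hNx, hp, polar_smul_left, hxp, smul_eq_mul,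
      smul_eq_mul]
    field_simp
    ring
  · rw [sub_eq_add_neg, QuadraticMap.map_add N, QuadraticMap.map_neg, QuadraticMap.map_smul, hNx, hp,
      polar_neg_right, polar_smul_left, hxp, smul_eq_mul, smul_eq_mul]
    field_simp
    ring
  · have : NeZero (2 : K) := ⟨h2⟩
    have : (1 / 2 : K) • x + (1 / 2 : K) • x = x := by
      rw [← add_smul, add_halves, one_smul]
    rw [← add_sub_assoc, add_right_comm, this, add_sub_cancel_right]

theorem exists_aut (hN : IsOctonionAlgebra N) (h2 : (2 : K) ≠ 0) {x y : C} (hx0 : x ≠ 0)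
    (hy0 : y ≠ 0) (hx : polar N x 1 = 0) (hy : polar N y 1 = 0) (hxy : N x = N y) :
    ∃ σ ∈ Aut K C, σ x = y := by
  by_cases h0 : N x = 0
  · obtain ⟨a, b, ha, hb, hab, hNa, hNb, rfl⟩ :=
      hN.exists_orthogonal_pair_of_isotropic h2 hx0 hx h0
    obtain ⟨a', b', ha', hb', hab', hNa', hNb', rfl⟩ :=
      hN.exists_orthogonal_pair_of_isotropic h2 hy0 hy (hxy ▸ h0)
    obtain ⟨σ, hσ, h1, h2⟩ := hN.exists_aut_of_orthogonal_pair h2 ha hb hab ha' hb' hab'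
      (hNa.trans hNa'.symm) (hNb.trans hNb'.symm) (by simp [hNa]) (by simp [hNb])
    exact ⟨σ, hσ, by rw [_root_.map_add, h1, h2]⟩
  · have hD := hN.correspondence_double (p := (x, x)) (hN.correspondence_one h2)
      (fun q hq => by
        obtain ⟨s, rfl⟩ := Submodule.mem_span_singleton.1 hq
        simp [polar_smul_left, polar_comm N 1, hx])
      (fun q hq => by
        obtain ⟨s, rfl⟩ := Submodule.mem_span_singleton.1 hq
        simp [polar_smul_left, polar_comm N 1, hx])
      rfl h0
    obtain ⟨b, hb, hb0⟩ := hN.exists_orthogonal hD.nondeg (by rw [hD.finrank_eq]; norm_num)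
    have h1b : polar N 1 b = 0 := hb 1 ⟨1, hD.one_mem, rfl⟩
    have hxb : polar N x b = 0 := hb x ⟨(x, x), mem_double.2 ⟨0, Submodule.zero_mem _, 1,
      Submodule.mem_span_singleton_self _, by simp⟩, rfl⟩
    obtain ⟨τ, hτN, hτx, hτf⟩ := exists_isometry h2 hxy (hxy ▸ h0)
    have hτ1 : τ 1 = 1 := hτf 1 (by rw [polar_comm, hx]) (by rw [polar_comm, hy])
    have hp := polar_isometry hτN
    obtain ⟨σ, hσ, h, -⟩ := hN.exists_aut_of_orthogonal_pair h2 (b' := τ b) hx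
      (by rw [polar_comm, h1b]) hxb hy (by rw [← hτ1, hp, polar_comm, h1b])
      (by rw [← hτx, hp, hxb]) hxy (hτN b).symm h0 hb0
    exact ⟨σ, hσ, h⟩

/-! ### Non-invertible pure elements -/

theorem isInvertible_iff (hN : IsOctonionAlgebra N) {x : C} : IsInvertible x ↔ N x ≠ 0 := by
  constructor
  · rintro ⟨y, hxy, -⟩ h
    have := hN.map_mul x y
    rw [hxy, hN.map_one, h, zero_mul] at this
    exact _root_.one_ne_zero this
  · intro h
    refine ⟨(N x)⁻¹ • conj N x, ?_, ?_⟩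
    · rw [mul_smul_comm, hN.mul_conj, inv_smul_smul₀ h]
    · rw [smul_mul_assoc, hN.conj_mul_self, inv_smul_smul₀ h]

/-- A split octonion algebra contains a non-zero isotropic pure element: if `x` is isotropic but
not pure, then `x b` is one, for `b` anisotropic and orthogonal to `1` and `x`. -/
theorem exists_isotropic_pure (hN : IsOctonionAlgebra N) (hs : IsSplit N) :
    ∃ x : C, x ≠ 0 ∧ polar N x 1 = 0 ∧ N x = 0 := by
  obtain ⟨x, hx0, hx⟩ := hs
  by_cases h1 : polar N x 1 = 0
  · exact ⟨x, hx0, h1, hx⟩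
  have hxx : polar N x x = 0 := by rw [polar_self, hx, smul_zero]
  have hD : NondegOn N (Submodule.span K {1, x}) := by
    intro z hz h
    obtain ⟨s, t, rfl⟩ := Submodule.mem_span_pair.1 hz
    have hz1 := h 1 (Submodule.subset_span (by simp))
    have hzx := h x (Submodule.subset_span (by simp))
    rw [polar_add_left, polar_smul_left, polar_smul_left, hxx, polar_comm N 1, smul_zero, add_zero,
      smul_eq_mul, mul_eq_zero, or_iff_left h1] at hzx
    rw [hzx, zero_smul, zero_add, polar_smul_left, smul_eq_mul, mul_eq_zero, or_iff_left h1] at hz1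
    rw [hzx, hz1]
    simp
  have hlt : Module.finrank K (Submodule.span K {1, x}) < 8 := by
    classical
    have h := finrank_span_finset_le_card (R := K) ({1, x} : Finset C)
    have := Finset.card_le_two (a := (1 : C)) (b := x)
    rw [Finset.coe_insert, Finset.coe_singleton] at h
    unfold Set.finrank at h
    omega
  obtain ⟨b, hb, hb0⟩ := hN.exists_orthogonal hD hlt
  have hb1 : polar N 1 b = 0 := hb 1 (Submodule.subset_span (by simp))
  have hbx : polar N x b = 0 := hb x (Submodule.subset_span (by simp))
  refine ⟨x * b, fun h => ?_, ?_, ?_⟩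
  · have := hN.polar_mul_right_mul_right b x 1
    rw [h, polar_zero_left] at this
    exact mul_ne_zero hb0 h1 this.symm
  · rw [polar_comm, ← hN.polar_conj_left]
    exact polar_conj_eq_zero (by rw [polar_comm, hb1]) hbx
  · rw [hN.map_mul, hx, zero_mul]

/-- The set of non-zero non-invertible pure elements is stable under automorphisms. The square of
an isotropic pure `x` vanishes, so that of `y = σ x` does too, whence `⟨y, 1⟩ y = N y`; if
`⟨y, 1⟩` were non-zero, then `y` and `x` would be scalars. -/
theorem aut_mem_pureNonInvertible (hN : IsOctonionAlgebra N) {σ : C ≃ₗ[K] C}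
    (hσ : σ ∈ Aut K C) {x : C} (hx : x ∈ pureNonInvertible N) : σ x ∈ pureNonInvertible N := by
  obtain ⟨hx0, hxp, hxi⟩ := hx
  have hNx : N x = 0 := by by_contra h; exact hxi (hN.isInvertible_iff.2 h)
  have hxx : x * x = 0 := by
    have := hN.mul_conj x
    rwa [show conj N x = -x from hxp, hNx, zero_smul, mul_neg, neg_eq_zero] at this
  have hyy : σ x * σ x = 0 := by rw [← hσ, hxx, map_zero]
  have hy0 : σ x ≠ 0 := fun h => hx0 (σ.map_eq_zero_iff.1 h)
  have hNy : N (σ x) = 0 := by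
    have := hN.map_mul (σ x) (σ x)
    rw [hyy, map_zero, eq_comm, mul_self_eq_zero] at this
    exact this
  refine ⟨hy0, hN.isPure_iff.2 ?_, fun h => hN.isInvertible_iff.1 h hNy⟩
  have := hN.mul_conj (σ x)
  rw [conj, mul_sub, hyy, hNy, zero_smul, sub_zero, mul_smul_comm, mul_one, smul_eq_zero] at this
  exact this.resolve_right hy0

end IsOctonionAlgebra

end OctonionAlg

theorem mainTheorem6 {K C : Type*} [Field K] (h2 : (2 : K) ≠ 0)
    [NonAssocRing C] [Module K C] [SMulCommClass K C C] [IsScalarTower K C C]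
    (N : QuadraticForm K C) (hN : OctonionAlg.IsOctonionAlgebra N) :
    (∀ x y : C, x ≠ 0 → y ≠ 0 → OctonionAlg.IsPure N x → OctonionAlg.IsPure N y → N x = N y →
      ∃ σ ∈ OctonionAlg.Aut K C, σ x = y) ∧
    (OctonionAlg.IsSplit N →
      OctonionAlg.ActsTransitivelyOn (OctonionAlg.Aut K C)
        (OctonionAlg.pureNonInvertible N)) := by
  have main : ∀ x y : C, x ≠ 0 → y ≠ 0 → OctonionAlg.IsPure N x → OctonionAlg.IsPure N y →
      N x = N y → ∃ σ ∈ OctonionAlg.Aut K C, σ x = y := fun x y hx0 hy0 hx hy hxy =>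
    hN.exists_aut h2 hx0 hy0 (hN.isPure_iff.1 hx) (hN.isPure_iff.1 hy) hxy
  refine ⟨main, fun hs => ⟨?_, ?_, ?_⟩⟩
  · obtain ⟨x, hx0, hx, hNx⟩ := hN.exists_isotropic_pure hs
    exact ⟨x, hx0, hN.isPure_iff.2 hx, fun h => hN.isInvertible_iff.1 h hNx⟩
  · exact fun g x hx => hN.aut_mem_pureNonInvertible g.2 hx
  · intro x hx y hy
    have hx' : N x = 0 := by by_contra h; exact hx.2.2 (hN.isInvertible_iff.2 h)
    have hy' : N y = 0 := by by_contra h; exact hy.2.2 (hN.isInvertible_iff.2 h)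
    obtain ⟨σ, hσ, h⟩ := main x y hx.1 hy.1 hx.2.1 hy.2.1 (hx'.trans hy'.symm)
    exact ⟨⟨σ, hσ⟩, h⟩
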